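/- **Setting.** Let $\theta\colon R\to S$ be a surjective homomorphism of coherent commutative rings such that $S$ is finitely presented as an $R$-module and $I=\ker\theta$ is nilpotent ($I^n=0$ for some $n$). Let $\mathcal C$ be an $R$-linear Grothendieck category, i.e. an $R$-linear abelian category with small colimits, exact small filtered colimits and a generator. For an $R$-linear category $\mathcal A$, the category $\mathcal A_S$ of $S$-objects has as objects the pairs $(A,\varphi)$ with $A\in\mathcal A$ and $\varphi\colon S\to\mathcal A(A,A)$ an $R$-algebra homomorphism, and as morphisms the morphisms of $\mathcal A$ that commute with the actions of $S$. An $R$-linear functor $G\colon\mathcal A\to\mathcal B$ induces $G_S\colon\mathcal A_S\to\mathcal B_S$. A *strict localization* of a Grothendieck category $\mathcal G$ is a full subcategory $\mathcal L\subset\mathcal G$, closed under isomorphisms, which is itself a Grothendieck category and whose embedding $\mathcal L\to\mathcal G$ has an exact left adjoint. If $i\colon\mathcal L\to\mathcal C$ is the embedding of a strict localization of $\mathcal C$, we identify $\mathcal L_S$ with its image under $i_S\colon\mathcal L_S\to\mathcal C_S$, i.e. with the full subcategory of all $(C,\varphi)\in\mathcal C_S$ such that $C\in\mathcal L$. **Theorem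 7.1.** For the nilpotent deformation $\mathcal C_S\to\mathcal C$ of Grothendieck categories, the assignment $\mathcal L\mapsto\mathcal L_S$ is a bijection from the set of strict localizations of $\mathcal C$ to the set of strict localizations of $\mathcal C_S$. The same holds for every $R$-deformation of Grothendieck categories $F\colon\mathcal D\to\mathcal C$, that is, for every $S$-linear Grothendieck category $\mathcal D$ and every $R$-linear functor $F$ whose induced functor $\widetilde F\colon\mathcal D\to\mathcal C_S$ is an equivalence: sending $\mathcal L$ to the full subcategory of all $D\in\mathcal D$ with $\widetilde F(D)\in\mathcal L_S$ is a bijection from the set of strict localizations of $\mathcal C$ to the set of strict localizations of $\mathcal D$. -/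

import Mathlib

open CategoryTheory CategoryTheory.Limits

universe w

namespace DefLoc

/-- A commutative ring is coherent if its finitely generated ideals are finitely presented. -/
def IsCoherentRing (R : Type*) [CommRing R] : Prop :=
  ∀ J : Ideal R, J.FG → Module.FinitePresentation R J

/-! ### The category of `S`-objects -/

section SObjects

variable (R S : Type*) [CommRing R] [CommRing S] [Algebra R S]

/-- An `S`-object of an `R`-linear category `C`: an object of `C` with an `R`-algebra map from `S`
to its endomorphism ring. -/
structure SObject (C : Type*) [Category C] [Preadditive C] [Linear R C] where
  obj : C
  act : S →ₐ[R] End obj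

namespace SObject

variable {R S}
variable {C : Type*} [Category C] [Preadditive C] [Linear R C]

/-- Morphisms of `S`-objects: the morphisms of `C` commuting with the action of `S`. -/
@[ext]
structure Hom (X Y : SObject R S C) where
  hom : X.obj ⟶ Y.obj
  comm : ∀ s : S, (show X.obj ⟶ X.obj from X.act s) ≫ hom =
    hom ≫ (show Y.obj ⟶ Y.obj from Y.act s)

/-- The category `C_S`. -/
instance : Category (SObject R S C) where
  Hom X Y := Hom X Y
  id X := ⟨𝟙 X.obj, fun s => by simp⟩
  comp f g := ⟨f.hom ≫ g.hom, fun s => by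
    rw [← Category.assoc, f.comm, Category.assoc, g.comm, Category.assoc]⟩
  id_comp f := Hom.ext (Category.id_comp f.hom)
  comp_id f := Hom.ext (Category.comp_id f.hom)
  assoc f g h := Hom.ext (Category.assoc f.hom g.hom h.hom)

variable (R S C) in
/-- The forgetful functor `C_S ⥤ C`. -/
def forget : SObject R S C ⥤ C where
  obj X := X.obj
  map f := Hom.hom f

end SObject

variable {R}
variable {C : Type*} [Category C] [Preadditive C] [Linear R C]
variable {D : Type*} [Category D] [Preadditive D]

/-- The functor `G_S : D_S ⥤ C_S` induced by an `R`-linear functor `G : D ⥤ C`. -/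
def mapSObject [Linear R D] (G : D ⥤ C) [G.Additive] [G.Linear R] :
    SObject R S D ⥤ SObject R S C where
  obj X :=
    { obj := G.obj X.obj
      act :=
        { toFun := fun s => G.map (show X.obj ⟶ X.obj from X.act s)
          map_one' := by
            rw [map_one]; exact G.map_id _
          map_mul' := fun s t => by
            rw [map_mul]; exact G.map_comp _ _
          map_zero' := by
            rw [map_zero]; exact G.map_zero _ _
          map_add' := fun s t => by
            rw [map_add]; exact G.map_add
          commutes' := fun r => by
            rw [AlgHom.commutes, Algebra.algebraMap_eq_smul_one, Algebra.algebraMap_eq_smul_one]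
            exact (G.map_smul r (𝟙 X.obj)).trans (by rw [G.map_id]; rfl) } }
  map f := ⟨G.map (SObject.Hom.hom f), fun s => by
    have h := congrArg G.map (SObject.Hom.comm f s)
    rw [G.map_comp, G.map_comp] at h
    exact h⟩
  map_id X := SObject.Hom.ext (G.map_id X.obj)
  map_comp f g := SObject.Hom.ext (G.map_comp (SObject.Hom.hom f) (SObject.Hom.hom g))

variable {S} in
/-- Let `D` be an `S`-linear category, regarded as an `R`-linear category by restriction of
scalars. An `R`-linear functor `F : D ⥤ C` induces the functor `D ⥤ C_S` that sends `d` to `F d`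
with `s : S` acting as `F (s • 𝟙 d)`. -/
def toSObject [Linear S D] (F : D ⥤ C) [F.Additive]
    (hF : ∀ {X Y : D} (r : R) (f : X ⟶ Y), F.map (algebraMap R S r • f) = r • F.map f) :
    D ⥤ SObject R S C where
  obj X :=
    { obj := F.obj X
      act :=
        { toFun := fun s => F.map (s • 𝟙 X)
          map_one' := by
            rw [one_smul]; exact F.map_id _
          map_mul' := fun s t => by
            refine Eq.trans ?_ (F.map_comp (t • 𝟙 X) (s • 𝟙 X))
            rw [Linear.smul_comp, Linear.comp_smul, Category.comp_id, smul_smul, mul_comm]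
          map_zero' := by
            rw [zero_smul]; exact F.map_zero _ _
          map_add' := fun s t => by
            rw [add_smul]; exact F.map_add
          commutes' := fun r => by
            rw [Algebra.algebraMap_eq_smul_one (A := End (F.obj X)), hF, F.map_id]
            rfl } }
  map {X Y} f := ⟨F.map f, fun s => by
    change F.map (s • 𝟙 X) ≫ F.map f = F.map f ≫ F.map (s • 𝟙 Y)
    rw [← F.map_comp, ← F.map_comp, Linear.smul_comp, Linear.comp_smul, Category.id_comp,
      Category.comp_id]⟩
  map_id X := SObject.Hom.ext (F.map_id X)
  map_comp f g := SObject.Hom.ext (F.map_comp f g)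

end SObjects

/-! ### Localizations -/

/-- `C` admits the structure of an abelian category (which is unique) and is a Grothendieck
category. -/
def IsGrothendieckCategory (C : Type*) [Category C] : Prop :=
  ∃ _ : Abelian C, IsGrothendieckAbelian.{w} C

/-- A localization: a fully faithful functor between Grothendieck categories which has an exact
left adjoint. -/
structure IsLocalizationFunctor {L C : Type*} [Category L] [Category C] (i : L ⥤ C) : Prop where
  source : IsGrothendieckCategory.{w} L
  target : IsGrothendieckCategory.{w} C
  full : i.Full
  faithful : i.Faithful
  exists_exact_leftAdjoint : ∃ a : C ⥤ L, Nonempty (a ⊣ i) ∧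
    PreservesFiniteLimits a ∧ PreservesFiniteColimits a

/-- The full subcategories `L` of `C`, closed under isomorphisms, whose embedding in `C` is a
localization. -/
def strictLocalizations (C : Type*) [Category C] : Set (ObjectProperty C) :=
  {L | L.IsClosedUnderIsomorphisms ∧ IsLocalizationFunctor.{w} L.ι}

/-- The full subcategory `L_S` of `C_S`: the closure under isomorphisms of the image of
`i_S : L_S ⥤ C_S`, where `i : L ⥤ C` is the embedding. -/
def baseChange {R : Type*} (S : Type*) [CommRing R] [CommRing S] [Algebra R S]
    {C : Type*} [Category C] [Preadditive C] [Linear R C] (L : ObjectProperty C) :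
    ObjectProperty (SObject R S C) :=
  (mapSObject S L.ι).essImage

/-- An `S`-object of `C` lies in `L_S` if and only if its underlying object lies in `L`. -/
theorem baseChange_iff {R S : Type*} [CommRing R] [CommRing S] [Algebra R S]
    {C : Type*} [Category C] [Preadditive C] [Linear R C] (L : ObjectProperty C)
    [L.IsClosedUnderIsomorphisms] (X : SObject R S C) :
    baseChange S L X ↔ L X.obj := by
  constructor
  · rintro ⟨Y, ⟨e⟩⟩
    exact L.prop_of_iso ((SObject.forget R S C).mapIso e) Y.obj.property
  · intro h
    let Y : SObject R S L.FullSubcategory :=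
      { obj := ⟨X.obj, h⟩
        act :=
          { toFun := fun s => ObjectProperty.homMk (show X.obj ⟶ X.obj from X.act s)
            map_one' := by rw [map_one]; rfl
            map_mul' := fun s t => by rw [map_mul]; rfl
            map_zero' := by rw [map_zero]; rfl
            map_add' := fun s t => by rw [map_add]; rfl
            commutes' := fun r => by rw [AlgHom.commutes]; rfl } }
    exact ⟨Y, ⟨eqToIso rfl⟩⟩

end DefLoc

/-!
Since `R → S` is surjective with kernel `I`, an action of `S` on an object of `C` is a property of
the object: `C_S` is the full subcategory of the objects annihilated by `I`
(`DefLoc.SObject.isEquivalence_toAnnihilated`). The proof compares strict localizations with the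
Serre classes closed under coproducts ("localizing classes"), first in `C` and then among the
annihilated objects.

By Gabriel's theorem, the strict localizations of a Grothendieck category are exactly the
subcategories of local objects for the isomorphisms modulo a localizing class `T`, and `T` can be
recovered as the class of objects without nonzero morphisms to local objects
(`exists_isLocalizing_of_mem_strictLocalizations`, `isLocal_isoModSerre_mem_strictLocalizations`,
`iff_of_isLocal`). The main point is the existence of reflections, `exists_isoModSerre_isLocal`:
the torsion-free quotient of an object is enlarged inside an injective object, with Zorn's lemma and
the AB5 axiom taking the place of an injective hull.

Restriction to the annihilated objects is a bijection on localizing classes. It is injective by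
dévissage (`prop_of_forall_annihilated_quotient`): as `I` is finitely generated and nilpotent, an
object lies in a Serre class once all its annihilated quotients do. It is surjective because the
objects all of whose annihilated subquotients lie in a given localizing class of annihilated objects
form a localizing class (`isLocalizing_annihilatedExtend`). Finally, restricting localizing classes
is compatible with restricting local objects (`isLocal_isoModSerre_inverseImage_annihilated`),
because the reflection of an annihilated object is annihilated. The statement for an arbitrary
deformation follows by transport along an equivalence.
-/

universe v u v' u'

namespace CategoryTheory.ObjectProperty

/-! ### Torsion theory of a Serre class -/

section Torsion

variable {C : Type u} [Category.{v} C] [Abelian C] (T : ObjectProperty C)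

/-- A localizing class: a Serre class closed under coproducts indexed by types in `Type w`. -/
class IsLocalizing : Prop extends T.IsSerreClass where
  closedUnderCoproducts : ∀ J : Type w, T.IsClosedUnderColimitsOfShape (Discrete J)

/-- `Y` is `T`-torsion-free if it receives no nonzero morphism from an object of `T`. -/
def TorsionFree (Y : C) : Prop :=
  ∀ ⦃A : C⦄ (g : A ⟶ Y), T A → g = 0

/-- `Y` is `T`-injective if morphisms to `Y` extend along the monomorphisms with cokernel
in `T`. -/
def TorsionInjective (Y : C) : Prop :=
  ∀ ⦃A B : C⦄ (i : A ⟶ B) [Mono i], T (cokernel i) → ∀ g : A ⟶ Y, ∃ g' : B ⟶ Y, i ≫ g' = g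

variable {T}

lemma TorsionFree.of_mono {X Y : C} (hY : T.TorsionFree Y) (f : X ⟶ Y) [Mono f] :
    T.TorsionFree X := fun A g hA => by
  rw [← cancel_mono f, zero_comp]
  exact hY _ hA

variable [T.IsSerreClass]

/-- A morphism out of a torsion-free object is a monomorphism as soon as its kernel is torsion. -/
lemma TorsionFree.mono_of_monoModSerre {X Y : C} (hX : T.TorsionFree X) {f : X ⟶ Y}
    (hf : T.monoModSerre f) : Mono f :=
  Preadditive.mono_of_kernel_zero (hX _ hf)

lemma prop_of_monoModSerre {X Y : C} {f : X ⟶ Y} (hf : T.monoModSerre f) (hY : T Y) : T X := by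
  rw [← T.monoModSerre_zero_iff X Y]
  have := T.monoModSerre.comp_mem f (0 : Y ⟶ Y) hf (by simpa using hY)
  simpa using this

/-- If `s : X ⟶ Y` has cokernel in `T`, then a morphism out of `Y` which is injective on `X` has
kernel in `T`, because this kernel embeds into the cokernel of `s`. -/
lemma monoModSerre_of_mono_comp {X Y Z : C} {s : X ⟶ Y} {f : Y ⟶ Z} (hs : T.epiModSerre s)
    [Mono (s ≫ f)] : T.monoModSerre f := by
  have : Mono (kernel.ι f ≫ cokernel.π s) := by
    rw [Preadditive.mono_iff_cancel_zero]
    intro W x hx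
    have hex : (ShortComplex.mk s (cokernel.π s) (by simp)).Exact :=
      ShortComplex.exact_of_g_is_cokernel _ (cokernelIsCokernel s)
    obtain ⟨W', p, _, y, hy⟩ := hex.exact_up_to_refinements (x ≫ kernel.ι f) (by simpa using hx)
    dsimp at y hy
    have hy0 : y = 0 := by
      rw [← cancel_mono (s ≫ f), ← Category.assoc, ← hy]
      simp
    rw [← cancel_epi p, ← cancel_mono (kernel.ι f), Category.assoc, hy, hy0]
    simp
  exact T.prop_of_mono (kernel.ι f ≫ cokernel.π s) hs

/-- Torsion-free `T`-injective objects are orthogonal to all isomorphisms modulo `T`. -/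
lemma isLocal_of_torsionFree_of_torsionInjective {Y : C} (h₁ : T.TorsionFree Y)
    (h₂ : T.TorsionInjective Y) : T.isoModSerre.isLocal Y := by
  intro A B f hf
  constructor
  · intro g₁ g₂ h
    dsimp at h
    have h0 : f ≫ (g₁ - g₂) = 0 := by rw [Preadditive.comp_sub, h, sub_self]
    have : cokernel.desc f _ h0 = 0 := h₁ _ hf.2
    rw [← sub_eq_zero, ← cokernel.π_desc f _ h0, this, comp_zero]
  · intro g
    have hk : kernel.ι f ≫ g = 0 := h₁ _ hf.1
    obtain ⟨g', hg'⟩ := h₂ (Abelian.factorThruCoimage f)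
      (T.prop_of_iso (cokernelIsoOfEq (Abelian.coimage.fac f).symm ≪≫
        cokernelEpiComp (Abelian.coimage.π f) (Abelian.factorThruCoimage f)) hf.2)
      (cokernel.desc _ g hk)
    refine ⟨g', ?_⟩
    dsimp
    rw [← Abelian.coimage.fac f, Category.assoc, hg']
    exact cokernel.π_desc _ _ _

open ZeroObject in
lemma torsionFree_of_isLocal {Y : C} (hY : T.isoModSerre.isLocal Y) : T.TorsionFree Y := by
  intro A g hA
  obtain ⟨g', hg'⟩ := (hY (0 : A ⟶ 0) (by simpa using ⟨hA, T.prop_zero⟩)).2 g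
  rw [← hg']
  exact zero_comp

lemma isoModSerre_cokernel_π {X Y : C} (f : X ⟶ Y) (hX : T X) :
    T.isoModSerre (cokernel.π f) :=
  T.isoModSerre_of_epi _ (T.prop_of_epi (Abelian.factorThruImage f) hX)

end Torsion

/-! ### Reflections modulo a localizing class -/

section Grothendieck

variable {C : Type u} [Category.{v} C] [Abelian C] [IsGrothendieckAbelian.{w} C]

/-- A morphism which is injective on each member of a nonempty chain of subobjects is injective on
their union. -/
lemma mono_sSup_arrow_comp {E E' : C} (f : E ⟶ E') (c : Set (Subobject E)) (hc : IsChain (· ≤ ·) c)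
    (hne : c.Nonempty) (hf : ∀ N ∈ c, Mono (N.arrow ≫ f)) : Mono ((sSup c).arrow ≫ f) := by
  obtain ⟨J, ⟨e⟩⟩ : ∃ J : Type w, Nonempty (J ≃ c) := ⟨_, ⟨(equivShrink.{w} c).symm⟩⟩
  let _ : PartialOrder J := PartialOrder.lift e e.injective
  have : Nonempty J := ⟨e.symm ⟨_, hne.some_mem⟩⟩
  have : IsDirectedOrder J := ⟨fun a b => by
    rcases hc.total (e a).2 (e b).2 with h | h
    · exact ⟨b, h, le_refl _⟩
    · exact ⟨a, le_refl _, h⟩⟩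
  let G : J ⥤ Subobject E :=
    Monotone.functor (f := fun j => (e j : Subobject E)) (fun _ _ h => h)
  let F : J ⥤ MonoOver E := G ⋙ Subobject.representative
  have hmk (j) : Subobject.mk (F.obj j).obj.hom = (e j : Subobject E) := by
    exact Subobject.mk_arrow (e j : Subobject E)
  let H := F ⋙ MonoOver.forget _ ⋙ Over.forget _
  let m : colimit H ⟶ E := colimit.desc H (Cocone.mk E
      { app j := (F.obj j).obj.hom
        naturality {j j'} g := by
          dsimp [H]
          simp })
  have hm (j) : colimit.ι H j ≫ m = (F.obj j).obj.hom :=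
    colimit.ι_desc _ j
  have := IsGrothendieckAbelian.mono_of_isColimit_monoOver F (colimit.isColimit H) m hm
  have hmk' := IsGrothendieckAbelian.subobjectMk_of_isColimit_eq_iSup F (colimit.isColimit H) m hm
  have hS : Subobject.mk m = sSup c := by
    rw [hmk']
    simp_rw [hmk]
    rw [sSup_eq_iSup']
    exact e.iSup_comp (g := fun N : c => (N : Subobject E))
  have hmf : Mono (m ≫ f) := by
    let α : H ⟶ (Functor.const _).obj E' :=
      { app j := (F.obj j).obj.hom ≫ f
        naturality {j j'} g := by
          dsimp [H]
          simp }
    have hα : ∀ j, Mono (α.app j) := fun j => hf _ (e j).2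
    have := NatTrans.mono_of_mono_app α
    have : IsConnected J := IsFiltered.isConnected J
    exact colim.map_mono' α (colimit.isColimit H) (isColimitConstCocone _ E') _
      (fun j =>
        ((Category.assoc _ _ _).symm.trans congr($(hm j) ≫ f)).trans (Category.comp_id _).symm)
  rw [← hS]
  have : (Subobject.mk m).arrow ≫ f = (Subobject.underlyingIso m).hom ≫ m ≫ f := by simp
  rw [this]
  infer_instance

variable (T : ObjectProperty C) [hT : T.IsLocalizing.{w}]

/-- Every object has a largest subobject in `T`, and the quotient by it is torsion-free. -/
lemma exists_mono_torsionFree_cokernel (X : C) :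
    ∃ (A : C) (i : A ⟶ X) (_ : Mono i), T A ∧ T.TorsionFree (cokernel i) := by
  let s : Set (Subobject X) := {N | T (N : C)}
  have hs : T ((sSup s : Subobject X) : C) := by
    refine T.prop_of_iso (Subobject.underlyingIso (image.ι (Subobject.smallCoproductDesc s))).symm ?_
    refine T.prop_of_epi (factorThruImage (Subobject.smallCoproductDesc s)) ?_
    have := hT.closedUnderCoproducts (equivShrink (Subobject X) '' s)
    refine T.prop_of_isColimit (coproductIsCoproduct _) ?_
    rintro ⟨_, ⟨N, hN, rfl⟩⟩
    simpa [s] using hN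
  refine ⟨_, (sSup s).arrow, inferInstance, hs, fun B g hB => ?_⟩
  have hπ : T.monoModSerre (cokernel.π (sSup s).arrow) :=
    (isoModSerre_cokernel_π _ hs).1
  have hP : T (pullback (cokernel.π (sSup s).arrow) g) :=
    prop_of_monoModSerre (MorphismProperty.pullback_snd _ g hπ) hB
  have hle : imageSubobject (pullback.fst (cokernel.π (sSup s).arrow) g) ≤ sSup s :=
    le_sSup (show _ ∈ s from T.prop_of_epi (factorThruImageSubobject _) hP)
  have h0 : pullback.fst (cokernel.π (sSup s).arrow) g ≫ cokernel.π (sSup s).arrow = 0 := by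
    rw [← imageSubobject_arrow_comp (pullback.fst (cokernel.π (sSup s).arrow) g),
      ← Subobject.ofLE_arrow hle]
    simp only [Category.assoc, cokernel.condition, comp_zero]
  rw [← cancel_epi (pullback.snd (cokernel.π (sSup s).arrow) g), ← pullback.condition, h0, comp_zero]

/-- Every object `M` embeds with cokernel in `T` into a `T`-injective object: embed `M` into an
injective object `E`, and take the inverse image in `E` of the largest subobject of `E / M` lying in
`T`. -/
lemma exists_mono_torsionInjective (M : C) :
    ∃ (K : C) (j : M ⟶ K) (_ : Mono j), T (cokernel j) ∧ T.TorsionInjective K := by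
  have ⟨A, i, _, hA, hfree⟩ := T.exists_mono_torsionFree_cokernel (cokernel (Injective.ι M))
  let j : M ⟶ pullback (cokernel.π (Injective.ι M)) i := pullback.lift (Injective.ι M) 0 (by simp)
  have hj : j ≫ pullback.fst _ _ = Injective.ι M := pullback.lift_fst _ _ _
  have hj' : j ≫ pullback.snd _ _ = 0 := pullback.lift_snd _ _ _
  have hex : (ShortComplex.mk j (pullback.snd _ _) hj').Exact := by
    rw [ShortComplex.exact_iff_exact_up_to_refinements]
    intro W x hx
    dsimp at x hx
    have hx' : (x ≫ pullback.fst _ _) ≫ cokernel.π (Injective.ι M) = 0 := by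
      rw [Category.assoc, pullback.condition, reassoc_of% hx, zero_comp]
    refine ⟨W, 𝟙 W, inferInstance, Abelian.monoLift (Injective.ι M) _ hx', ?_⟩
    dsimp
    rw [← cancel_mono (pullback.fst _ _), Category.assoc, Category.assoc, hj]
    simp
  have hjm : Mono j := mono_of_mono_fac hj
  have hmono : Mono (cokernel.desc j _ hj') := hex.mono_cokernelDesc
  refine ⟨_, j, hjm, T.prop_of_mono (cokernel.desc j _ hj') hA, ?_⟩
  intro A' B i' _ hi' g
  let h : B ⟶ Injective.under M := Injective.factorThru (g ≫ pullback.fst _ _) i'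
  have hh : i' ≫ h = g ≫ pullback.fst _ _ := Injective.comp_factorThru _ _
  have h0 : i' ≫ h ≫ cokernel.π (Injective.ι M) ≫ cokernel.π i = 0 := by
    rw [reassoc_of% hh, pullback.condition_assoc]
    simp
  have h1 : (h ≫ cokernel.π (Injective.ι M)) ≫ cokernel.π i = 0 := by
    rw [Category.assoc, ← cokernel.π_desc i' _ h0, hfree (cokernel.desc i' _ h0) hi', comp_zero]
  refine ⟨pullback.lift h (Abelian.monoLift i _ h1) (by simp), ?_⟩
  rw [← cancel_mono (pullback.fst _ _), Category.assoc, pullback.lift_fst, hh]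

/-- Every torsion-free object embeds with cokernel in `T` into a torsion-free `T`-injective
object. The `T`-injective object `K` containing `M` need not be torsion-free; a subobject `N` of `K`
containing `M` which is maximal among those without torsion inherits `T`-injectivity, since each of
its torsion-free extensions by an object of `T` embeds into `K` over `N`. -/
lemma TorsionFree.exists_mono_torsionFree_torsionInjective {M : C} (hM : T.TorsionFree M) :
    ∃ (N : C) (j : M ⟶ N) (_ : Mono j), T (cokernel j) ∧ T.TorsionFree N ∧
      T.TorsionInjective N := by
  obtain ⟨K, jK, _, hjK, hK⟩ := T.exists_mono_torsionInjective M
  obtain ⟨A, i, _, hA, hfree⟩ := T.exists_mono_torsionFree_cokernel K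
  have hπ : T.monoModSerre (cokernel.π i) := (isoModSerre_cokernel_π i hA).1
  have hjπ : Mono (jK ≫ cokernel.π i) := hM.mono_of_monoModSerre
    (T.monoModSerre.comp_mem _ _ (T.monoModSerre_of_mono jK) hπ)
  -- A maximal subobject of `K` containing `M` and meeting the torsion of `K` trivially.
  let S : Set (Subobject K) := {N | Subobject.mk jK ≤ N ∧ Mono (N.arrow ≫ cokernel.π i)}
  have hmkS {Z : C} (φ : Z ⟶ K) [Mono φ] (hle : Subobject.mk jK ≤ Subobject.mk φ)
      (hm : Mono (φ ≫ cokernel.π i)) : Subobject.mk φ ∈ S := by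
    refine ⟨hle, ?_⟩
    have : (Subobject.mk φ).arrow ≫ cokernel.π i =
      (Subobject.underlyingIso φ).hom ≫ φ ≫ cokernel.π i := by simp
    rw [this]
    infer_instance
  obtain ⟨N, hMN, hN⟩ := zorn_le_nonempty₀ S (fun c hcS hc N hN => ⟨sSup c,
    ⟨(hcS hN).1.trans (le_sSup hN), mono_sSup_arrow_comp _ c hc ⟨N, hN⟩ fun N' h => (hcS h).2⟩,
    fun _ => le_sSup⟩) _ (hmkS jK le_rfl hjπ)
  have hNm : Mono (N.arrow ≫ cokernel.π i) := hN.prop.2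
  let j : M ⟶ (N : C) := Subobject.ofMkLE jK N hMN
  have hj : j ≫ N.arrow = jK := Subobject.ofMkLE_arrow hMN
  have hjm : Mono j := mono_of_mono_fac hj
  have hNfree : T.TorsionFree (N : C) := hfree.of_mono (N.arrow ≫ cokernel.π i)
  refine ⟨N, j, hjm, ?_, hNfree, ?_⟩
  · have hjK' : T.isoModSerre jK := T.isoModSerre_of_mono jK hjK
    have hNK : T.isoModSerre N.arrow := by
      refine T.isoModSerre_of_mono N.arrow ?_
      have h0 : jK ≫ cokernel.π N.arrow = 0 := by rw [← hj]; simp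
      have : Epi (cokernel.desc jK _ h0) := epi_of_epi_fac (cokernel.π_desc jK _ h0)
      exact T.prop_of_epi (cokernel.desc jK _ h0) hjK
    exact (T.isoModSerre.of_postcomp j N.arrow hNK (by rwa [hj])).2
  · intro A₀ B s _ hs g
    -- It suffices to split the pushout of `s` along `g`, made torsion-free.
    have hinl : T.isoModSerre (pushout.inl g s) :=
      MorphismProperty.pushout_inl g s (T.isoModSerre_of_mono s hs)
    obtain ⟨A', i', _, hA', hfree'⟩ := T.exists_mono_torsionFree_cokernel (pushout g s)
    have hq : T.isoModSerre (cokernel.π i') := 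
      isoModSerre_cokernel_π i' hA'
    have hc := T.isoModSerre.comp_mem _ _ hinl hq
    have hcm : Mono (pushout.inl g s ≫ cokernel.π i') := hNfree.mono_of_monoModSerre hc.1
    obtain ⟨φ, hφ⟩ := hK _ hc.2 N.arrow
    have hφm : Mono ((pushout.inl g s ≫ cokernel.π i') ≫ φ ≫ cokernel.π i) := by
      rwa [← Category.assoc, hφ]
    have hφm' : Mono (φ ≫ cokernel.π i) := hfree'.mono_of_monoModSerre
      (monoModSerre_of_mono_comp hc.2)
    have : Mono φ := mono_of_mono φ (cokernel.π i)
    have hNφ : N ≤ Subobject.mk φ := Subobject.le_mk_of_comm _ hφ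
    have hφN : Subobject.mk φ ≤ N := hN.le_of_ge (hmkS φ (hMN.trans hNφ) hφm') hNφ
    refine ⟨pushout.inr g s ≫ cokernel.π i' ≫ Subobject.ofMkLE φ N hφN, ?_⟩
    rw [← pushout.condition_assoc, ← cancel_mono N.arrow]
    simpa using congr(g ≫ $hφ)

/-- Every object has a reflection in the subcategory of local objects. -/
lemma exists_isoModSerre_isLocal (X : C) :
    ∃ (Y : C) (f : X ⟶ Y), T.isoModSerre f ∧ T.isoModSerre.isLocal Y := by
  obtain ⟨A, i, _, hA, hfree⟩ := T.exists_mono_torsionFree_cokernel X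
  obtain ⟨N, j, _, hj, h₁, h₂⟩ := hfree.exists_mono_torsionFree_torsionInjective T
  refine ⟨N, cokernel.π i ≫ j, T.isoModSerre.comp_mem _ _ (isoModSerre_cokernel_π i hA)
    (T.isoModSerre_of_mono j hj), isLocal_of_torsionFree_of_torsionInjective h₁ h₂⟩

end Grothendieck

/-! ### Strict localizations and localizing classes -/

section Gabriel

lemma isClosedUnderColimitsOfShape_isZero (C : Type u) [Category.{v} C] [HasZeroMorphisms C]
    (J : Type u') [Category.{v'} J] : IsClosedUnderColimitsOfShape (IsZero (C := C)) J where
  colimitsOfShape_le X := by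
    rintro ⟨p⟩
    rw [IsZero.iff_id_eq_zero]
    exact p.isColimit.hom_ext fun j => (p.prop_diag_obj j).eq_of_src _ _

variable {C : Type u} [Category.{v} C] [Abelian C]

/-- A strict localization consists of the local objects for the kernel of its reflector. -/
lemma exists_isLocalizing_of_mem_strictLocalizations {L : ObjectProperty C}
    (hL : L ∈ DefLoc.strictLocalizations.{w} C) :
    ∃ (T : ObjectProperty C) (_ : T.IsLocalizing.{w}), L = T.isoModSerre.isLocal := by
  obtain ⟨hiso, hL⟩ := hL
  obtain ⟨_, _⟩ := hL.source
  obtain ⟨a, ⟨adj⟩, _, _⟩ := hL.exists_exact_leftAdjoint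
  have := adj.leftAdjoint_preservesColimits
  have := isClosedUnderColimitsOfShape_isZero L.FullSubcategory
  have hcop : ∀ J : Type w, a.kernel.IsClosedUnderColimitsOfShape (Discrete J) := fun J =>
    inferInstance
  let _ : a.kernel.IsLocalizing.{w} := { closedUnderCoproducts := hcop }
  refine ⟨a.kernel, inferInstance, ?_⟩
  have hW : a.kernel.isoModSerre = L.isLocal := by
    rw [Abelian.isoModSerre_kernel_eq_isLocal_of_rightAdjoint adj]
    congr 1
    ext X
    exact ⟨fun ⟨Y, hY⟩ => hY ▸ Y.2, fun hX => ⟨⟨X, hX⟩, rfl⟩⟩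
  rw [hW]
  refine le_antisymm L.le_isLocal_isLocal fun Y hY => ?_
  have hη : L.isLocal (adj.unit.app Y) := fun Z hZ =>
    isLocal_adj_unit_app adj Y Z ⟨⟨Z, hZ⟩, rfl⟩
  obtain ⟨r, hr⟩ := (hY (adj.unit.app Y) hη).2 (𝟙 Y)
  have : IsIso (adj.unit.app Y) := ⟨r, hr, (hη _ (a.obj Y).2).1 (by
    dsimp at hr ⊢
    rw [reassoc_of% hr]
    exact (Category.comp_id _).symm)⟩
  exact L.prop_of_iso (asIso (adj.unit.app Y)).symm (a.obj Y).2

variable [IsGrothendieckAbelian.{w} C]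

/-- A reflective subcategory of a Grothendieck category whose reflector is left exact is a
Grothendieck category. -/
lemma isGrothendieckCategory_of_reflective {D : Type u'} [Category.{v'} D] [Preadditive D]
    {i : D ⥤ C} [i.Full] [i.Faithful] {a : C ⥤ D} (adj : a ⊣ i) [PreservesFiniteLimits a] :
    DefLoc.IsGrothendieckCategory.{w} D := by
  let _ : Reflective i := { L := a, adj := adj }
  have : HasFiniteProducts D := ⟨fun n => hasLimitsOfShape_of_reflective i⟩
  have : a.PreservesZeroMorphisms := by
    have := adj.isLeftAdjoint
    infer_instance
  let _ : Abelian D := abelianOfAdjunction i a (asIso adj.counit) adj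
  have : HasFilteredColimitsOfSize.{w, w} D := ⟨fun J _ _ => hasColimitsOfShape_of_reflective i⟩
  refine ⟨inferInstance, ?_, inferInstance, ⟨fun J _ _ => adj.hasExactColimitsOfShape J⟩, ?_⟩
  · exact locallySmall_of_faithful i
  · refine ⟨a.obj (separator C), (isSeparator_def _).2 fun X Y f g h => i.map_injective ?_⟩
    refine (isSeparator_def _).1 (isSeparator_separator C) _ _ fun e => ?_
    have := congr(adj.homEquiv _ _ $(h ((adj.homEquiv _ _).symm e)))
    rwa [adj.homEquiv_naturality_right, adj.homEquiv_naturality_right, Equiv.apply_symm_apply]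
      at this

section

variable (T : ObjectProperty C) [hT : T.IsLocalizing.{w}]

/-- The morphisms orthogonal to all local objects are the isomorphisms modulo `T`. -/
lemma isLocal_isLocal_isoModSerre : T.isoModSerre.isLocal.isLocal = T.isoModSerre := by
  refine le_antisymm (fun X Y f hf => ?_) T.isoModSerre.le_isLocal_isLocal
  obtain ⟨X', p, hp, hX'⟩ := T.exists_isoModSerre_isLocal X
  obtain ⟨Y', q, hq, hY'⟩ := T.exists_isoModSerre_isLocal Y
  obtain ⟨f', hf'⟩ := (hY' p hp).2 (f ≫ q)
  dsimp at hf'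
  have hp' := T.isoModSerre.le_isLocal_isLocal _ hp
  have hq' := T.isoModSerre.le_isLocal_isLocal _ hq
  have : T.isoModSerre.isLocal.isLocal f' := MorphismProperty.of_precomp _ p f' hp'
    (by rw [hf']; exact MorphismProperty.comp_mem _ _ _ hf hq')
  have : IsIso f' := (isLocal_iff_isIso _ f' hX' hY').1 this
  refine T.isoModSerre.of_postcomp f q hq ?_
  rw [← hf']
  exact T.isoModSerre.comp_mem _ _ hp (T.isoModSerre_of_isIso f')

lemma isRightAdjoint_ι_isLocal_isoModSerre : T.isoModSerre.isLocal.ι.IsRightAdjoint := by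
  rw [Functor.isRightAdjoint_iff_leftAdjointObjIsDefined_eq_top]
  ext X
  obtain ⟨Y, f, hf, hY⟩ := T.exists_isoModSerre_isLocal X
  let c : (T.isoModSerre.isLocal.ι ⋙ coyoneda.obj (Opposite.op X)).CorepresentableBy ⟨Y, hY⟩ :=
    { homEquiv {A} := (fullyFaithfulι _).homEquiv.trans (Equiv.ofBijective _ (A.2 f hf))
      homEquiv_comp _ _ := by simp [Functor.FullyFaithful.homEquiv] }
  exact iff_of_true c.isCorepresentable trivial

/-- Gabriel's theorem: the local objects for a localizing class form a strict localization. -/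
lemma isLocal_isoModSerre_mem_strictLocalizations :
    T.isoModSerre.isLocal ∈ DefLoc.strictLocalizations.{w} C := by
  let L := T.isoModSerre.isLocal
  have := T.isRightAdjoint_ι_isLocal_isoModSerre
  let a := L.ι.leftAdjoint
  let adj : a ⊣ L.ι := Adjunction.ofIsRightAdjoint L.ι
  have hW : isLocal (· ∈ Set.range L.ι.obj) = T.isoModSerre := by
    rw [← T.isLocal_isLocal_isoModSerre]
    congr 1
    ext X
    exact ⟨fun ⟨Y, hY⟩ => hY ▸ Y.2, fun hX => ⟨⟨X, hX⟩, rfl⟩⟩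
  have hloc := isLocalization_isLocal adj
  rw [hW] at hloc
  have : a.Additive := adj.left_adjoint_additive
  have h₁ := SerreClassLocalization.preservesFiniteLimits a T
  have h₂ := SerreClassLocalization.preservesFiniteColimits a T
  exact ⟨inferInstance, isGrothendieckCategory_of_reflective adj, ⟨inferInstance, inferInstance⟩,
    inferInstance, inferInstance, a, ⟨adj⟩, h₁, h₂⟩

/-- A localizing class is recovered from its local objects. -/
lemma iff_of_isLocal (X : C) :
    T X ↔ ∀ Y, T.isoModSerre.isLocal Y → ∀ f : X ⟶ Y, f = 0 := by
  refine ⟨fun hX Y hY f => torsionFree_of_isLocal hY f hX, fun h => ?_⟩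
  obtain ⟨Y, f, hf, hY⟩ := T.exists_isoModSerre_isLocal X
  rw [h Y hY f, isoModSerre_zero_iff] at hf
  exact hf.1

end

end Gabriel

lemma isLocal_isoModSerre_congr {C : Type u} [Category.{v} C] [Abelian C]
    {T₁ T₂ : ObjectProperty C} [T₁.IsSerreClass] [T₂.IsSerreClass] (h : T₁ = T₂) :
    T₁.isoModSerre.isLocal = T₂.isoModSerre.isLocal := by
  subst h
  rfl

/-! ### Objects annihilated by an ideal -/

section Annihilated

variable {R : Type*} [CommRing R] (I : Ideal R)

section

variable (C : Type u) [Category.{v} C] [Preadditive C] [Linear R C]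

/-- The objects annihilated by the ideal `I`. -/
def annihilated : ObjectProperty C := fun X => ∀ r ∈ I, r • 𝟙 X = 0

variable {C I}

lemma annihilated_of_span {s : Set R} {X : C} (h : ∀ r ∈ s, r • 𝟙 X = 0) :
    annihilated (Ideal.span s) C X := fun r hr => by
  induction hr using Submodule.span_induction with
  | mem r hr => exact h r hr
  | zero => exact zero_smul _ _
  | add a b _ _ ha hb => rw [add_smul, ha, hb, add_zero]
  | smul a b _ hb => rw [smul_eq_mul, mul_smul, hb, smul_zero]

instance : (annihilated I C).IsClosedUnderSubobjects where
  prop_of_mono f _ h r hr := by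
    rw [← cancel_mono f, Linear.smul_comp, Category.id_comp, zero_comp, ← Category.comp_id f,
      ← Linear.comp_smul, h r hr, comp_zero]

instance : (annihilated I C).IsClosedUnderQuotients where
  prop_of_epi f _ h r hr := by
    rw [← cancel_epi f, Linear.comp_smul, Category.comp_id, comp_zero, ← Category.id_comp f,
      ← Linear.smul_comp, h r hr, zero_comp]

instance (J : Type u') [Category.{v'} J] : (annihilated I C).IsClosedUnderLimitsOfShape J where
  limitsOfShape_le X := by
    rintro ⟨p⟩ r hr
    refine p.isLimit.hom_ext fun j => ?_
    rw [Linear.smul_comp, Category.id_comp, zero_comp, ← Category.comp_id (p.cone.π.app j),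
      ← Linear.comp_smul]
    exact (congrArg _ (p.prop_diag_obj j r hr)).trans comp_zero

instance (J : Type u') [Category.{v'} J] : (annihilated I C).IsClosedUnderColimitsOfShape J where
  colimitsOfShape_le X := by
    rintro ⟨p⟩ r hr
    refine p.isColimit.hom_ext fun j => ?_
    rw [Linear.comp_smul, Category.comp_id, comp_zero, ← Category.id_comp (p.cocone.ι.app j),
      ← Linear.smul_comp]
    exact (congrArg (· ≫ _) (p.prop_diag_obj j r hr)).trans zero_comp

instance [HasZeroObject C] : (annihilated I C).ContainsZero where
  exists_zero := ⟨_, isZero_zero C, fun _ _ => (isZero_zero C).eq_of_src _ _⟩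

instance : (annihilated I C).IsClosedUnderFiniteProducts where

end

section

variable {C : Type u} [Category.{v} C] [Abelian C] [Linear R C]

variable {I} in
/-- Dévissage: if `I` is finitely generated and nilpotent, then an object lies in a Serre class `Q`
as soon as all its quotients annihilated by `I` do. One generator `a` is treated at a time: if
the cokernel of multiplication by `a` lies in `Q`, then so does the cokernel of multiplication by
`a ^ m` for each `m`, as epimorphisms modulo `Q` compose, and some power of `a` is zero. -/
lemma prop_of_forall_annihilated_quotient (hI : I.FG) (hnil : IsNilpotent I) (Q : ObjectProperty C)
    [Q.IsSerreClass] {X : C}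
    (h : ∀ (B : C) (e : X ⟶ B) [Epi e], annihilated I C B → Q B) : Q X := by
  obtain ⟨n, hn⟩ := hnil
  obtain ⟨s, rfl⟩ := hI
  replace hn : ∀ r ∈ s, r ^ n = 0 := fun r hr => by
    have := Ideal.pow_mem_pow (Ideal.subset_span hr) n
    rwa [hn] at this
  replace h : ∀ (B : C) (e : X ⟶ B) [Epi e], (∀ r ∈ s, r • 𝟙 B = 0) → Q B :=
    fun B e _ hB => h B e (annihilated_of_span hB)
  classical
  induction s using Finset.induction_on generalizing X with
  | empty => exact h X (𝟙 X) (by simp)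
  | insert a s _ ih =>
    have key {B : C} (e : X ⟶ B) [Epi e] (he : (a • 𝟙 X) ≫ e = 0) : a • 𝟙 B = 0 := by
      rw [← cancel_epi e, Linear.comp_smul, Category.comp_id, comp_zero, ← he, Linear.smul_comp,
        Category.id_comp]
    have hcoker : Q.epiModSerre (a • 𝟙 X) := by
      refine ih (fun r hr => hn r (Finset.mem_insert_of_mem hr)) fun B e _ hB => ?_
      refine h B (cokernel.π (a • 𝟙 X) ≫ e) fun r hr => ?_
      obtain rfl | hr := Finset.mem_insert.1 hr
      · exact key (cokernel.π (r • 𝟙 X) ≫ e) (by rw [cokernel.condition_assoc, zero_comp])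
      · exact hB r hr
    have hpow (m : ℕ) : Q.epiModSerre (a ^ m • 𝟙 X) := by
      induction m with
      | zero => simpa using Q.epiModSerre.id_mem X
      | succ m ihm =>
        have := Q.epiModSerre.comp_mem _ _ ihm hcoker
        rwa [Linear.comp_smul, Category.comp_id, smul_smul, ← pow_succ'] at this
    have := hpow n
    rwa [hn a (Finset.mem_insert_self a s), zero_smul, epiModSerre_zero_iff] at this

variable {I} in
/-- Reflections in subcategories of local objects preserve annihilation, since a morphism out of
the reflection is determined by its restriction along the reflection morphism. -/
lemma annihilated_of_isLocal {W : MorphismProperty C} {X Y : C} {f : X ⟶ Y} (hf : W f)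
    (hX : annihilated I C X) (hY : W.isLocal Y) : annihilated I C Y := fun r hr =>
  (hY f hf).1 <| by
    dsimp
    rw [Linear.comp_smul, Category.comp_id, comp_zero, ← Category.id_comp f, ← Linear.smul_comp,
      hX r hr, zero_comp]

end

variable {C : Type u} [Category.{v} C] [Abelian C] [Linear R C]

instance : PreservesFiniteLimits (annihilated I C).ι where
  preservesFiniteLimits _ := inferInstance

instance : PreservesFiniteColimits (annihilated I C).ι where
  preservesFiniteColimits _ := inferInstance

variable {I}

lemma isoModSerre_inverseImage_annihilated_iff (T : ObjectProperty C) [T.IsSerreClass]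
    {X Y : (annihilated I C).FullSubcategory} (f : X ⟶ Y) :
    (T.inverseImage (annihilated I C).ι).isoModSerre f ↔
      T.isoModSerre ((annihilated I C).ι.map f) :=
  and_congr (T.prop_iff_of_iso (PreservesKernel.iso (annihilated I C).ι f))
    (T.prop_iff_of_iso (PreservesCokernel.iso (annihilated I C).ι f))

section Extend

variable (T' : ObjectProperty (annihilated I C).FullSubcategory)

/-- The objects of `C` all of whose subquotients annihilated by `I` lie in `T'`, for a class `T'` of
annihilated objects. -/
def annihilatedExtend : ObjectProperty C := fun X =>
  ∀ ⦃A B : C⦄ (i : A ⟶ X) [Mono i] (p : A ⟶ B) [Epi p] (h : annihilated I C B), T' ⟨B, h⟩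

lemma annihilatedExtend_iff [T'.IsSerreClass] (X : (annihilated I C).FullSubcategory) :
    annihilatedExtend T' X.obj ↔ T' X := by
  refine ⟨fun h => h (𝟙 _) (𝟙 _) X.2, fun h A B i _ p _ hB => ?_⟩
  let A' : (annihilated I C).FullSubcategory := ⟨A, prop_of_mono _ i X.2⟩
  let i' : A' ⟶ X := homMk i
  let p' : A' ⟶ ⟨B, hB⟩ := homMk p
  have : Mono i' := (annihilated I C).ι.mono_of_mono_map (by assumption)
  have : Epi p' := (annihilated I C).ι.epi_of_epi_map (by assumption)
  exact T'.prop_of_epi p' (T'.prop_of_mono i' h)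

instance [T'.IsSerreClass] : (annihilatedExtend T').IsSerreClass where
  exists_zero := ⟨_, (annihilated I C).ι.map_isZero (isZero_zero (annihilated I C).FullSubcategory),
    (annihilatedExtend_iff T' _).2 T'.prop_zero⟩
  prop_of_mono f _ h A B i _ p _ hB := h (i ≫ f) p hB
  prop_of_epi f _ h A B i _ p _ hB := h (pullback.fst f i) (pullback.snd f i ≫ p) hB
  prop_X₂_of_shortExact {S} hS h₁ h₃ A B i _ p _ hB := by
    -- The subquotient `B` of `S.X₂` is an extension of a subquotient of `S.X₃` by one of `S.X₁`:
    -- the image of `kernel (i ≫ S.g)` in `B`, and the cokernel of that image.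
    have := hS.mono_f
    let k := kernel.ι (i ≫ S.g)
    let l : kernel (i ≫ S.g) ⟶ S.X₁ := hS.exact.lift (k ≫ i) (by simp [k])
    have hl : l ≫ S.f = k ≫ i := hS.exact.lift_f _ _
    have : Mono l := mono_of_mono_fac hl
    let q : Abelian.coimage (i ≫ S.g) ⟶ cokernel (k ≫ p) :=
      cokernel.desc _ (p ≫ cokernel.π (k ≫ p)) (by rw [← Category.assoc]; exact cokernel.condition _)
    have : Epi q := epi_of_epi_fac (cokernel.π_desc (kernel.ι (i ≫ S.g)) _ _)
    let S' : ShortComplex (annihilated I C).FullSubcategory :=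
      { X₁ := ⟨Abelian.image (k ≫ p), prop_of_mono _ (Abelian.image.ι (k ≫ p)) hB⟩
        X₂ := ⟨B, hB⟩
        X₃ := ⟨cokernel (k ≫ p), prop_of_epi _ (cokernel.π (k ≫ p)) hB⟩
        f := homMk (Abelian.image.ι (k ≫ p))
        g := homMk (cokernel.π (k ≫ p))
        zero := hom_ext _ (kernel.condition _) }
    have hS' : S'.Exact := by
      rw [← ShortComplex.exact_map_iff_of_faithful _ (annihilated I C).ι]
      exact ShortComplex.exact_of_f_is_kernel _ (kernelIsKernel (cokernel.π (k ≫ p)))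
    exact T'.prop_X₂_of_exact hS' (h₁ l (Abelian.factorThruImage (k ≫ p)) _)
      (h₃ (Abelian.factorThruCoimage (i ≫ S.g)) q _)

end Extend

variable [IsGrothendieckAbelian.{w} C]

variable (I) in
instance isGrothendieckAbelian_annihilated :
    IsGrothendieckAbelian.{w} (annihilated I C).FullSubcategory := by
  have : HasFilteredColimitsOfSize.{w, w} (annihilated I C).FullSubcategory :=
    ⟨fun J _ _ => inferInstance⟩
  refine ⟨locallySmall_of_faithful (annihilated I C).ι, inferInstance,
    ⟨fun J _ _ => HasExactColimitsOfShape.domain_of_functor J (annihilated I C).ι⟩, ?_⟩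
  -- The coproduct of all annihilated quotients of a separator is a separator.
  let κ := {N : Subobject (separator C) // annihilated I C (cokernel N.arrow)}
  let G (k : Shrink.{w} κ) : (annihilated I C).FullSubcategory :=
    ⟨_, ((equivShrink κ).symm k).2⟩
  have hG : (ObjectProperty.ofObj G).IsSeparating := by
    intro X Y f g h
    refine (annihilated I C).ι.map_injective
      ((isSeparator_def _).1 (isSeparator_separator C) _ _ fun e => ?_)
    have hex : (ShortComplex.mk (kernelSubobject e).arrow e (by simp)).Exact := by
      rw [ShortComplex.exact_iff_exact_up_to_refinements]
      intro W x hx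
      exact ⟨W, 𝟙 W, inferInstance, factorThruKernelSubobject e x hx, by simp⟩
    let m : cokernel (kernelSubobject e).arrow ⟶ X.obj := cokernel.desc _ e (by simp)
    have : Mono m := hex.mono_cokernelDesc
    let k : κ := ⟨kernelSubobject e, prop_of_mono _ m X.2⟩
    obtain ⟨k', hk'⟩ := (equivShrink κ).symm.surjective k
    have hGk : G k' = ⟨_, k.2⟩ := by dsimp only [G]; rw [hk']
    have := congr(cokernel.π (kernelSubobject e).arrow ≫ (annihilated I C).ι.map
      $(h ⟨_, k.2⟩ (hGk ▸ ofObj_apply G k') (homMk m)))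
    simpa [m] using this
  exact ⟨_, hG.isSeparator_coproduct⟩

instance (T : ObjectProperty C) [hT : T.IsLocalizing.{w}] :
    (T.inverseImage (annihilated I C).ι).IsLocalizing.{w} where
  closedUnderCoproducts J := by
    have := hT.closedUnderCoproducts J
    infer_instance

/-- An annihilated object is local for a localizing class if and only if it is local for the
restriction of this class to the annihilated objects: its reflection is again annihilated, hence can
be computed among the annihilated objects. -/
lemma isLocal_isoModSerre_inverseImage_annihilated (T : ObjectProperty C) [T.IsLocalizing.{w}] :
    (T.inverseImage (annihilated I C).ι).isoModSerre.isLocal =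
      T.isoModSerre.isLocal.inverseImage (annihilated I C).ι := by
  have key : T.isoModSerre.isLocal.inverseImage (annihilated I C).ι ≤
      (T.inverseImage (annihilated I C).ι).isoModSerre.isLocal := by
    intro Y hY A B f hf
    rw [isoModSerre_inverseImage_annihilated_iff] at hf
    have h := hY _ hf
    refine ⟨fun g₁ g₂ hg => (annihilated I C).ι.map_injective (h.1 ?_), fun g => ?_⟩
    · simpa using congr((annihilated I C).ι.map $hg)
    · obtain ⟨g', hg'⟩ := h.2 ((annihilated I C).ι.map g)
      exact ⟨homMk g', (annihilated I C).ι.map_injective (by simpa using hg')⟩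
  refine le_antisymm (fun Y hY => ?_) key
  obtain ⟨Z, f, hf, hZ⟩ := T.exists_isoModSerre_isLocal ((annihilated I C).ι.obj Y)
  let Z' : (annihilated I C).FullSubcategory := ⟨Z, annihilated_of_isLocal hf Y.2 hZ⟩
  let f' : Y ⟶ Z' := homMk f
  have hf' : (T.inverseImage (annihilated I C).ι).isoModSerre f' :=
    (isoModSerre_inverseImage_annihilated_iff T f').2 hf
  have : IsIso f' := (isLocal_iff_isIso _ f' hY (key _ hZ)).1
    (MorphismProperty.le_isLocal_isLocal _ _ hf')
  exact prop_of_iso _ (asIso f').symm (show T.isoModSerre.isLocal.inverseImage _ Z' from hZ)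

/-- The extended class is closed under coproducts: by dévissage only annihilated quotients `B` of a
coproduct matter, and such a `B` is covered by the coproduct of the images of the summands. -/
lemma isLocalizing_annihilatedExtend
    (T' : ObjectProperty (annihilated I C).FullSubcategory) (hI : I.FG) (hnil : IsNilpotent I)
    [hT' : T'.IsLocalizing.{w}] : (annihilatedExtend T').IsLocalizing.{w} where
  closedUnderCoproducts J := ⟨by
    rintro X ⟨φ⟩
    refine prop_of_forall_annihilated_quotient hI hnil _ fun B e _ hB => ?_
    let B' : (annihilated I C).FullSubcategory := ⟨B, hB⟩
    rw [show B = B'.obj from rfl, annihilatedExtend_iff]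
    let e' (j : J) : φ.diag.obj ⟨j⟩ ⟶ B := φ.ι.app ⟨j⟩ ≫ e
    let M (j : J) : (annihilated I C).FullSubcategory :=
      ⟨Abelian.image (e' j), prop_of_mono _ (Abelian.image.ι (e' j)) hB⟩
    have := hT'.closedUnderCoproducts J
    have hM : T' (∐ M) := T'.prop_of_isColimit (coproductIsCoproduct _) fun j =>
      φ.prop_diag_obj j (𝟙 _) (Abelian.factorThruImage (e' j.as)) _
    let d : ∐ M ⟶ B' := Limits.Sigma.desc fun j => (homMk (Abelian.image.ι (e' j)) : M j ⟶ B')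
    have hd (j : J) : Limits.Sigma.ι M j ≫ d = (homMk (Abelian.image.ι (e' j)) : M j ⟶ B') :=
      Limits.Sigma.ι_desc _ _
    have : Epi d := by
      refine ⟨fun {Z} g₁ g₂ h => (annihilated I C).ι.map_injective ?_⟩
      rw [← cancel_epi e]
      refine φ.isColimit.hom_ext fun ⟨j⟩ => ?_
      have hj : (homMk (Abelian.image.ι (e' j)) : M j ⟶ B') ≫ g₁ =
          homMk (Abelian.image.ι (e' j)) ≫ g₂ := by
        rw [← hd, Category.assoc, Category.assoc, h]
      have := congr(Abelian.factorThruImage (e' j) ≫ (annihilated I C).ι.map $hj)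
      simpa [e'] using this
    exact T'.prop_of_epi d hM⟩

/-- Strict localizations of a Grothendieck category correspond to strict localizations of the full
subcategory of the objects annihilated by a finitely generated nilpotent ideal. -/
lemma bijOn_strictLocalizations_annihilated (hI : I.FG) (hnil : IsNilpotent I) :
    Set.BijOn (fun L : ObjectProperty C => L.inverseImage (annihilated I C).ι)
      (DefLoc.strictLocalizations.{w} C)
      (DefLoc.strictLocalizations.{w} (annihilated I C).FullSubcategory) := by
  refine ⟨fun L hL => ?_, fun L₁ hL₁ L₂ hL₂ h => ?_, fun L hL => ?_⟩
  · obtain ⟨T, _, rfl⟩ := exists_isLocalizing_of_mem_strictLocalizations hL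
    dsimp
    rw [← isLocal_isoModSerre_inverseImage_annihilated]
    exact isLocal_isoModSerre_mem_strictLocalizations _
  · obtain ⟨T₁, _, rfl⟩ := exists_isLocalizing_of_mem_strictLocalizations hL₁
    obtain ⟨T₂, _, rfl⟩ := exists_isLocalizing_of_mem_strictLocalizations hL₂
    dsimp at h
    rw [← isLocal_isoModSerre_inverseImage_annihilated,
      ← isLocal_isoModSerre_inverseImage_annihilated] at h
    have hP (X : (annihilated I C).FullSubcategory) : T₁ X.obj ↔ T₂ X.obj := by
      have h₁ := iff_of_isLocal (T₁.inverseImage (annihilated I C).ι) X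
      have h₂ := iff_of_isLocal (T₂.inverseImage (annihilated I C).ι) X
      rw [h] at h₁
      exact h₁.trans h₂.symm
    obtain rfl : T₁ = T₂ := by
      ext X
      exact ⟨fun hX => prop_of_forall_annihilated_quotient hI hnil _ fun B e _ hB =>
          (hP ⟨B, hB⟩).1 (T₁.prop_of_epi e hX),
        fun hX => prop_of_forall_annihilated_quotient hI hnil _ fun B e _ hB =>
          (hP ⟨B, hB⟩).2 (T₂.prop_of_epi e hX)⟩
    rfl
  · obtain ⟨T', _, rfl⟩ := exists_isLocalizing_of_mem_strictLocalizations hL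
    have := isLocalizing_annihilatedExtend T' hI hnil
    refine ⟨_, isLocal_isoModSerre_mem_strictLocalizations (annihilatedExtend T'), ?_⟩
    dsimp
    rw [← isLocal_isoModSerre_inverseImage_annihilated]
    refine isLocal_isoModSerre_congr ?_
    ext X
    exact annihilatedExtend_iff T' X

end Annihilated

end CategoryTheory.ObjectProperty

namespace DefLoc

/-! ### Transport along equivalences -/

section Equivalence

lemma IsGrothendieckCategory.of_equivalence {A : Type u} [Category.{v} A] {B : Type u'}
    [Category.{v'} B] (e : A ≌ B) (hB : IsGrothendieckCategory.{w} B) :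
    IsGrothendieckCategory.{w} A := by
  obtain ⟨_, _⟩ := hB
  let _ : Preadditive A := .ofFullyFaithful e.fullyFaithfulFunctor
  have : HasFiniteProducts A :=
    ⟨fun n => Adjunction.hasLimitsOfShape_of_equivalence e.functor⟩
  let _ : Abelian A := abelianOfEquivalence e.functor
  exact ⟨inferInstance, .of_equivalence e.symm⟩

variable {A : Type u} [Category.{v} A] {B : Type u'} [Category.{v'} B] (F : A ⥤ B)
  [F.IsEquivalence]

lemma inverseImage_mem_strictLocalizations {L : ObjectProperty B}
    (hL : L ∈ strictLocalizations.{w} B) : L.inverseImage F ∈ strictLocalizations.{w} A := by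
  obtain ⟨hiso, hL⟩ := hL
  obtain ⟨a, ⟨adj⟩, _, _⟩ := hL.exists_exact_leftAdjoint
  let G : (L.inverseImage F).FullSubcategory ⥤ L.FullSubcategory :=
    L.lift ((L.inverseImage F).ι ⋙ F) fun X => X.2
  have : G.Faithful := ⟨fun h => (L.inverseImage F).ι.map_injective
    (F.map_injective (congrArg L.ι.map h))⟩
  have : G.Full := ⟨fun f => ⟨ObjectProperty.homMk (F.preimage f.hom),
    L.ι.map_injective (F.map_preimage f.hom)⟩⟩
  have : G.EssSurj := ⟨fun Y => ⟨⟨F.objPreimage Y.obj,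
    L.prop_of_iso (F.objObjPreimageIso Y.obj).symm Y.2⟩,
    ⟨L.isoMk (F.objObjPreimageIso Y.obj)⟩⟩⟩
  have : G.IsEquivalence := {}
  let i : G ⋙ L.ι ⋙ F.inv ≅ (L.inverseImage F).ι :=
    Functor.isoWhiskerLeft (L.inverseImage F).ι F.asEquivalence.unitIso.symm
  refine ⟨inferInstance, hL.source.of_equivalence G.asEquivalence,
    hL.target.of_equivalence F.asEquivalence, inferInstance, inferInstance, F ⋙ a ⋙ G.inv,
    ⟨((F.asEquivalence.toAdjunction.comp adj).comp
      G.asEquivalence.symm.toAdjunction).ofNatIsoRight i⟩, ?_, ?_⟩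
  · infer_instance
  · infer_instance

/-- Strict localizations correspond to each other under an equivalence of categories. -/
lemma bijOn_strictLocalizations_inverseImage :
    Set.BijOn (fun L : ObjectProperty B => L.inverseImage F) (strictLocalizations.{w} B)
      (strictLocalizations.{w} A) := by
  refine ⟨fun L hL => inverseImage_mem_strictLocalizations F hL, fun L₁ hL₁ L₂ hL₂ h => ?_,
    fun L hL => ⟨_, inverseImage_mem_strictLocalizations F.inv hL, ?_⟩⟩
  · have := hL₁.1
    have := hL₂.1
    ext Y
    rw [← L₁.prop_iff_of_iso (F.objObjPreimageIso Y), ← L₂.prop_iff_of_iso (F.objObjPreimageIso Y)]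
    exact Iff.of_eq (congrFun h (F.objPreimage Y))
  · have := hL.1
    ext X
    exact L.prop_iff_of_iso (F.asEquivalence.unitIso.app X).symm

end Equivalence

/-! ### Objects with an action of a quotient ring -/

section SObject

variable {R S : Type*} [CommRing R] [CommRing S] [Algebra R S]
  {C : Type*} [Category C] [Preadditive C] [Linear R C]

lemma SObject.annihilated_ker (X : SObject R S C) :
    ObjectProperty.annihilated (RingHom.ker (algebraMap R S)) C X.obj := fun r hr => by
  have h := X.act.commutes r
  rw [RingHom.mem_ker.1 hr, map_zero, Algebra.algebraMap_eq_smul_one] at h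
  exact h.symm

variable (R S C) in
/-- The forgetful functor from `S`-objects to the objects annihilated by the kernel of
`R → S`. -/
def SObject.toAnnihilated :
    SObject R S C ⥤
      (ObjectProperty.annihilated (RingHom.ker (algebraMap R S)) C).FullSubcategory :=
  ObjectProperty.lift _ (SObject.forget R S C) SObject.annihilated_ker

/-- If `R → S` is surjective, then an action of `S` on an object of `C` is a property of the
object. -/
lemma SObject.isEquivalence_toAnnihilated (hsurj : Function.Surjective (algebraMap R S)) :
    (SObject.toAnnihilated R S C).IsEquivalence where
  faithful := ⟨fun h => SObject.Hom.ext (congrArg (ObjectProperty.ι _).map h)⟩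
  full := ⟨fun {X Y} f => ⟨⟨f.hom, fun s => by
    obtain ⟨r, rfl⟩ := hsurj s
    rw [X.act.commutes, Y.act.commutes, Algebra.algebraMap_eq_smul_one,
      Algebra.algebraMap_eq_smul_one]
    have h (g : X.obj ⟶ Y.obj) : (r • 𝟙 X.obj) ≫ g = g ≫ (r • 𝟙 Y.obj) := by simp
    exact h f.hom⟩, rfl⟩⟩
  essSurj := ⟨fun Y => ⟨⟨Y.obj,
    (Ideal.Quotient.liftₐ (RingHom.ker (Algebra.ofId R S)) (Algebra.ofId R (End Y.obj))
      fun r hr => by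
        rw [Algebra.ofId_apply, Algebra.algebraMap_eq_smul_one]
        exact Y.2 r hr).comp
      (Ideal.quotientKerAlgEquivOfSurjective (f := Algebra.ofId R S) hsurj).symm.toAlgHom⟩,
    ⟨Iso.refl _⟩⟩⟩

end SObject

end DefLoc

theorem theorem7p1 {R S : Type*} [CommRing R] [CommRing S] [Algebra R S]
    (hR : DefLoc.IsCoherentRing R) (hS : DefLoc.IsCoherentRing S)
    [Module.FinitePresentation R S]
    (hsurj : Function.Surjective (algebraMap R S))
    (hnil : IsNilpotent (RingHom.ker (algebraMap R S)))
    {C : Type*} [Category C] [Abelian C] [Linear R C] [IsGrothendieckAbelian.{w} C] :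
    Set.BijOn (fun L : ObjectProperty C => DefLoc.baseChange S L)
      (DefLoc.strictLocalizations.{w} C)
      (DefLoc.strictLocalizations.{w} (DefLoc.SObject R S C)) ∧
    ∀ {D : Type*} [Category D] [Abelian D] [Linear S D] [IsGrothendieckAbelian.{w} D]
      (F : D ⥤ C) [F.Additive]
      (hF : ∀ {X Y : D} (r : R) (f : X ⟶ Y), F.map (algebraMap R S r • f) = r • F.map f),
      (DefLoc.toSObject F hF).IsEquivalence →
      Set.BijOn
        (fun L : ObjectProperty C =>
          (DefLoc.baseChange S L).inverseImage (DefLoc.toSObject F hF))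
        (DefLoc.strictLocalizations.{w} C)
        (DefLoc.strictLocalizations.{w} D) := by
  have hfg : (RingHom.ker (algebraMap R S)).FG :=
    Module.FinitePresentation.fg_ker (Algebra.linearMap R S) hsurj
  have := DefLoc.SObject.isEquivalence_toAnnihilated (C := C) hsurj
  have h₁ := (DefLoc.bijOn_strictLocalizations_inverseImage.{w}
    (DefLoc.SObject.toAnnihilated R S C)).comp
    (ObjectProperty.bijOn_strictLocalizations_annihilated hfg hnil)
  have h₂ : Set.BijOn (fun L : ObjectProperty C => DefLoc.baseChange S L)
      (DefLoc.strictLocalizations.{w} C)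
      (DefLoc.strictLocalizations.{w} (DefLoc.SObject R S C)) := by
    refine h₁.congr fun L hL => ?_
    have := hL.1
    ext X
    exact (DefLoc.baseChange_iff L X).symm
  refine ⟨h₂, fun F _ hF hE => ?_⟩
  exact (DefLoc.bijOn_strictLocalizations_inverseImage.{w} (DefLoc.toSObject F hF)).comp h₂
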